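/- Let $\Omega\subset\mathbb R^2$ be a bounded open set (for instance a bounded Lipschitz domain), and let $H^1_0(\Omega)$ be the closure of $C_c^\infty(\Omega)$ in $H^1(\Omega)$. Call $C_p>0$ admissible for $\Omega$ if for every $f\in L^2(\Omega)$ every weak solution $u\in H^1_0(\Omega)$ of $-\Delta u=f$ satisfies $\|\nabla u\|_{L^2(\Omega)}\le C_p\|f\|_{L^2(\Omega)}$. For $\epsilon>0$ and $\boldsymbol f=(f_1,f_2,f_3)\in (L^2(\Omega))^3$, the weak form of the steady-state Poisson–Nernst–Planck system $-\Delta p-\nabla\cdot(p\nabla\psi)=f_1$, $-\Delta n+\nabla\cdot(n\nabla\psi)=f_2$, $-\epsilon\Delta\psi=p-n+f_3$ is, for $\boldsymbol u=(p,n,\psi)$, $$\langle \boldsymbol F(\boldsymbol u),\boldsymbol v\rangle=\int_\Omega\big(\nabla p\cdot\nabla v_1+p\nabla\psi\cdot\nabla v_1+\nabla n\cdot\nabla v_2-n\nabla\psi\cdot\nabla v_2+\epsilon\nabla\psi\cdot\nabla v_3-pv_3+nv_3-f_1v_1-f_2v_2-f_3v_3\big)\,dx .$$ For $p,n\in L^\infty(\Omega)$,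 $\psi\in W^{1,\infty}(\Omega)$ and $\boldsymbol\phi,\boldsymbol v\in (H^1_0(\Omega))^3$ put $$\langle \boldsymbol{DF}(\boldsymbol u)\boldsymbol\phi,\boldsymbol v\rangle=\int_\Omega\big(\nabla\phi_1\cdot\nabla v_1+p\nabla\phi_3\cdot\nabla v_1+\phi_1\nabla\psi\cdot\nabla v_1+\nabla\phi_2\cdot\nabla v_2-n\nabla\phi_3\cdot\nabla v_2-\phi_2\nabla\psi\cdot\nabla v_2+\epsilon\nabla\phi_3\cdot\nabla v_3-\phi_1v_3+\phi_2v_3\big)\,dx .$$ **Lemma.** An admissible constant $C_p$, depending only on $\Omega$, exists. Let $C_p$ be any admissible constant, let $\epsilon>0$, $p,n\in L^\infty(\Omega)$, $\psi\in W^{1,\infty}(\Omega)$, and suppose that $$\|\nabla\psi\|_{L^\infty(\Omega)}+\sqrt2\,C_p\,\epsilon^{-1}\max\{\|p\|_{L^\infty(\Omega)},\|n\|_{L^\infty(\Omega)}\}<\frac{\sqrt2}{1+C_p^2},$$ where $\|\nabla\psi\|_{L^\infty(\Omega)}=\max\{\|\partial_x\psi\|_{L^\infty(\Omega)},\|\partial_y\psi\|_{L^\infty(\Omega)}\}$.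 Then: 1. If moreover $p,n\in H^1(\Omega)$, then $\boldsymbol{DF}(\boldsymbol u)$ is the G-derivative of $\boldsymbol F$ at $\boldsymbol u$: for every $\boldsymbol f\in(L^2(\Omega))^3$ and all $\boldsymbol\phi,\boldsymbol v\in(H^1_0(\Omega))^3$ for which the integrand of $\langle\boldsymbol F(\boldsymbol u+t\boldsymbol\phi),\boldsymbol v\rangle$ is integrable for all $t\in\mathbb R$, $$\lim_{t\to0}\frac{\langle\boldsymbol F(\boldsymbol u+t\boldsymbol\phi)-\boldsymbol F(\boldsymbol u),\boldsymbol v\rangle}{t}=\langle\boldsymbol{DF}(\boldsymbol u)\boldsymbol\phi,\boldsymbol v\rangle .$$ 2. For every $\boldsymbol R=(R_1,R_2,R_3)\in(L^2(\Omega))^3$ there is exactly one $\boldsymbol\phi\in(H^1_0(\Omega))^3$ such that $$\langle\boldsymbol{DF}(\boldsymbol u)\boldsymbol\phi,\boldsymbol v\rangle=\sum_{k=1}^3\int_\Omega R_kv_k\,dx\qquad\text{for all }\boldsymbol v\in(H^1_0(\Omega))^3 .$$ -/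

import Mathlib

open MeasureTheory TopologicalSpace Filter
open scoped ENNReal Topology Distributions

namespace PNP

/-- The plane `ℝ²` with its Euclidean structure. -/
abbrev Plane := EuclideanSpace ℝ (Fin 2)

/-- Lebesgue measure on `Ω`. -/
noncomputable abbrev vol (Ω : Opens Plane) : Measure Plane :=
  volume.restrict (Ω : Set Plane)

/-- The real space `L²(Ω)`. -/
noncomputable abbrev L2 (Ω : Opens Plane) := Lp ℝ 2 (vol Ω)

/-- The classical partial derivative `∂ᵢη`. -/
noncomputable def partialDeriv (i : Fin 2) (η : Plane → ℝ) (x : Plane) : ℝ :=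
  fderiv ℝ η x (EuclideanSpace.single i 1)

theorem testFunction_memLp {Ω : Opens Plane} (η : 𝓓(Ω, ℝ)) : MemLp η 2 (vol Ω) :=
  (η.continuous.memLp_of_hasCompactSupport η.hasCompactSupport).restrict _

theorem testFunction_partialDeriv_memLp {Ω : Opens Plane} (η : 𝓓(Ω, ℝ)) (i : Fin 2) :
    MemLp (partialDeriv i η) 2 (vol Ω) := by
  have hc : Continuous (partialDeriv i η) :=
    (η.contDiff.continuous_fderiv (by simp)).clm_apply continuous_const
  have hs : HasCompactSupport (partialDeriv i η) :=
    η.hasCompactSupport.fderiv_apply ℝ (EuclideanSpace.single i 1)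
  exact (hc.memLp_of_hasCompactSupport hs).restrict _

/-- The Hilbert space of pairs `(u, g)` with `u ∈ L²(Ω)` and `g ∈ L²(Ω)²`, with the norm
`(‖u‖² + ‖g₁‖² + ‖g₂‖²)^{1/2}`. A Sobolev function is represented by the pair `(u, ∇u)`, so that
this norm is its `H¹(Ω)` norm. -/
noncomputable abbrev L2Pair (Ω : Opens Plane) := WithLp 2 (L2 Ω × PiLp 2 (fun _ : Fin 2 => L2 Ω))

/-- The pair `(η, ∇η)` of a test function `η ∈ C_c^∞(Ω)`. -/
noncomputable def testPair {Ω : Opens Plane} (η : 𝓓(Ω, ℝ)) : L2Pair Ω :=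
  WithLp.toLp 2 ((testFunction_memLp η).toLp η,
    WithLp.toLp 2 fun i => (testFunction_partialDeriv_memLp η i).toLp (partialDeriv i η))

/-- The space `H¹₀(Ω)`: the closure of `C_c^∞(Ω)` in the `H¹` norm. An element is a pair `(u, ∇u)`;
the second component is the weak gradient and is determined by the first. -/
noncomputable def H10 (Ω : Opens Plane) : Submodule ℝ (L2Pair Ω) :=
  (Submodule.span ℝ (Set.range (testPair (Ω := Ω)))).topologicalClosure

/-- A function on the plane together with the two components of its (weak) gradient. -/
abbrev Jet := (Plane → ℝ) × (Fin 2 → Plane → ℝ)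

/-- Representatives of `u` and `∇u` for `u ∈ H¹₀(Ω)`. -/
noncomputable def jet {Ω : Opens Plane} (w : H10 Ω) : Jet :=
  (fun x => (w : L2Pair Ω).fst x, fun i x => (w : L2Pair Ω).snd i x)

/-- Representatives of the components of `φ ∈ (H¹₀(Ω))³` and of their gradients. -/
noncomputable def jets {Ω : Opens Plane} (φ : Fin 3 → H10 Ω) : Fin 3 → Jet := fun k => jet (φ k)

/-- The seminorm `|u|_{1,Ω} = ‖∇u‖_{L²(Ω)}`. -/
noncomputable def gradNorm {Ω : Opens Plane} (w : H10 Ω) : ℝ := ‖(w : L2Pair Ω).snd‖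

/-- `g` is the weak gradient of `u` in `Ω`. -/
def HasWeakGradient (Ω : Opens Plane) (u : Plane → ℝ) (g : Fin 2 → Plane → ℝ) : Prop :=
  LocallyIntegrableOn u Ω ∧ (∀ i, LocallyIntegrableOn (g i) Ω) ∧
    ∀ (i : Fin 2) (η : 𝓓(Ω, ℝ)),
      ∫ x in Ω, u x * partialDeriv i η x = -∫ x in Ω, g i x * η x

/-- `u ∈ W^{1,q}(Ω)` with weak gradient `g`. -/
def MemW1 (Ω : Opens Plane) (q : ℝ≥0∞) (u : Plane → ℝ) (g : Fin 2 → Plane → ℝ) : Prop :=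
  HasWeakGradient Ω u g ∧ MemLp u q (vol Ω) ∧ ∀ i, MemLp (g i) q (vol Ω)

/-- The norm of `L^∞(Ω)` (essential supremum of `|u|`), for `u ∈ L^∞(Ω)`. -/
noncomputable def normLinf (Ω : Opens Plane) (u : Plane → ℝ) : ℝ :=
  (eLpNorm u ∞ (vol Ω)).toReal

/-- The `L^∞` norm of a vector field: the larger one of the norms of its two components. -/
noncomputable def normLinfVec (Ω : Opens Plane) (g : Fin 2 → Plane → ℝ) : ℝ :=
  max (normLinf Ω (g 0)) (normLinf Ω (g 1))

/-- The pointwise Euclidean product of two vector fields. -/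
def dot (a b : Fin 2 → Plane → ℝ) (x : Plane) : ℝ := ∑ i, a i x * b i x

/-- `u ∈ H¹₀(Ω)` is a weak solution of `-Δu = f` in `Ω`, `u = 0` on `∂Ω`. -/
def IsPoissonSolution {Ω : Opens Plane} (f : L2 Ω) (u : H10 Ω) : Prop :=
  ∀ v : H10 Ω, ∫ x in Ω, dot (jet u).2 (jet v).2 x = ∫ x in Ω, f x * (jet v).1 x

/-- `C` is an admissible constant `C_p` for `Ω`: `|u|_{1,Ω} ≤ C ‖f‖_{L²(Ω)}` for the weak solution
`u ∈ H¹₀(Ω)` of `-Δu = f`, for all `f ∈ L²(Ω)`. -/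
def IsPoissonConstant (Ω : Opens Plane) (C : ℝ) : Prop :=
  0 < C ∧ ∀ (f : L2 Ω) (u : H10 Ω), IsPoissonSolution f u → gradNorm u ≤ C * ‖f‖

/-- The integrand of `⟨F(u), v⟩`, for `u = (p, n, ψ)` and the source terms `f = (f₁, f₂, f₃)`. -/
def pnpIntegrand (ε : ℝ) (f : Fin 3 → Plane → ℝ) (u v : Fin 3 → Jet) (x : Plane) : ℝ :=
  dot (u 0).2 (v 0).2 x + (u 0).1 x * dot (u 2).2 (v 0).2 x
    + dot (u 1).2 (v 1).2 x - (u 1).1 x * dot (u 2).2 (v 1).2 x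
    + ε * dot (u 2).2 (v 2).2 x - (u 0).1 x * (v 2).1 x + (u 1).1 x * (v 2).1 x
    - f 0 x * (v 0).1 x - f 1 x * (v 1).1 x - f 2 x * (v 2).1 x

/-- The weak form `⟨F(u), v⟩` of the nonlinear steady-state Poisson-Nernst-Planck system
`-Δp - ∇·(p∇ψ) = f₁`, `-Δn + ∇·(n∇ψ) = f₂`, `-εΔψ = p - n + f₃`. -/
noncomputable def pnpForm (Ω : Opens Plane) (ε : ℝ) (f : Fin 3 → Plane → ℝ)
    (u v : Fin 3 → Jet) : ℝ :=
  ∫ x in Ω, pnpIntegrand ε f u v x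

/-- The linearized form `⟨DF(u)φ, v⟩` at `u = (p, n, ψ)`, where `gψ = ∇ψ`. -/
noncomputable def linearizedForm (Ω : Opens Plane) (ε : ℝ) (p n : Plane → ℝ)
    (gψ : Fin 2 → Plane → ℝ) (φ v : Fin 3 → Jet) : ℝ :=
  ∫ x in Ω,
    (dot (φ 0).2 (v 0).2 x + p x * dot (φ 2).2 (v 0).2 x + (φ 0).1 x * dot gψ (v 0).2 x
      + dot (φ 1).2 (v 1).2 x - n x * dot (φ 2).2 (v 1).2 x - (φ 1).1 x * dot gψ (v 1).2 x
      + ε * dot (φ 2).2 (v 2).2 x - (φ 0).1 x * (v 2).1 x + (φ 1).1 x * (v 2).1 x)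

/-- `φ ∈ (H¹₀(Ω))³` solves the linearized problem `⟨DF(u)φ, v⟩ = ⟨R, v⟩` for all
`v ∈ (H¹₀(Ω))³`. -/
def IsLinearizedSolution {Ω : Opens Plane} (ε : ℝ) (p n : Plane → ℝ)
    (gψ : Fin 2 → Plane → ℝ) (R : Fin 3 → L2 Ω) (φ : Fin 3 → H10 Ω) : Prop :=
  ∀ v : Fin 3 → H10 Ω,
    linearizedForm Ω ε p n gψ (jets φ) (jets v)
      = ∑ k, ∫ x in Ω, R k x * (jets v k).1 x

/-- The limit defining the G-derivative: `⟨F(u + tφ) - F(u), v⟩ / t → ℓ` as `t → 0`. -/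
def HasGDerivative (Ω : Opens Plane) (ε : ℝ) (f : Fin 3 → Plane → ℝ)
    (u φ v : Fin 3 → Jet) (l : ℝ) : Prop :=
  Tendsto (fun t : ℝ => (pnpForm Ω ε f (u + t • φ) v - pnpForm Ω ε f u v) / t) (𝓝[≠] 0) (𝓝 l)

end PNP

open PNP

namespace PNP

variable {Ω : Opens Plane}

/-! Solvability. The form `DF(u)` need not be coercive on the diagonal: the mass coupling of φ₁, φ₂
with v₃ carries no small factor, while the coupling of φ₃ with v₁, v₂ has size N = max(‖p‖, ‖n‖). It
is therefore tested with Sφ = (φ₁, φ₂, αφ₃). Write X, Y, Z for the gradient norms of φ₁, φ₂, φ₃ and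
C for a Poincaré constant. With αC² = N both couplings have the same bound, and DF(u)(φ, Sφ) ≥ (1 -
θ)(X² + Y²) + αεZ² - 2NZ(X + Y), θ = √2 C ‖∇ψ‖. The right side is positive definite when 2N² < (1 -
θ)αε, which for N > 0 reads θ + 2NC²/ε < 1. This follows from the smallness hypothesis multiplied by
√2 C, because 2C/(1 + C²) ≤ 1. As S is onto, Lax–Milgram for B(·, S·) gives existence and uniqueness
(`existsUnique_of_coercive`, `exists_tripleForm_coercive`).

Constants. A Poincaré constant exists by the Sobolev inequality and is admissible. Conversely, every
admissible constant is a Poincaré constant by duality (`IsPoissonConstant.poincare`), so the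
estimate above applies to any given C_p.

Derivative. The integrand of ⟨F(u + tφ), v⟩ is a quadratic polynomial in t whose linear coefficient
is the integrand of `DF(u)`. -/

/-! ### Bounded weights on L²(Ω). -/

theorem integrable_weight_mul {g : Plane → ℝ} (hg : MemLp g ⊤ (vol Ω)) (a b : L2 Ω) :
    Integrable (fun x => g x * (a x * b x)) (vol Ω) := by
  have h : MemLp (fun x => g x * a x) 2 (vol Ω) := (Lp.memLp a).mul' hg
  have := h.integrable_mul (Lp.memLp b)
  refine this.congr (Eventually.of_forall fun x => ?_)
  simp [mul_assoc]

theorem memLp_weight_mul {g : Plane → ℝ} (hg : MemLp g ⊤ (vol Ω)) (a : L2 Ω) :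
    MemLp (fun x => g x * a x) 2 (vol Ω) := (Lp.memLp a).mul' hg

theorem norm_weight_mul_le {g : Plane → ℝ} (hg : MemLp g ⊤ (vol Ω)) (a : L2 Ω) :
    ‖(memLp_weight_mul hg a).toLp _‖ ≤ normLinf Ω g * ‖a‖ := by
  rw [Lp.norm_toLp, Lp.norm_def, normLinf, ← ENNReal.toReal_mul]
  refine ENNReal.toReal_mono
    (ENNReal.mul_ne_top hg.eLpNorm_ne_top (Lp.memLp a).eLpNorm_ne_top) ?_
  exact eLpNorm_smul_le_eLpNorm_top_mul_eLpNorm 2 (Lp.memLp a).1 g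

theorem abs_integral_weight_mul_le {g : Plane → ℝ} (hg : MemLp g ⊤ (vol Ω)) (a b : L2 Ω) :
    |∫ x in Ω, g x * (a x * b x)| ≤ normLinf Ω g * ‖a‖ * ‖b‖ := by
  have h : ∫ x in Ω, g x * (a x * b x) = inner ℝ b ((memLp_weight_mul hg a).toLp _) := by
    rw [L2.inner_def]
    refine integral_congr_ae ?_
    filter_upwards [(memLp_weight_mul hg a).coeFn_toLp] with x hx
    simp [hx, mul_assoc]
  rw [h]
  calc _ ≤ ‖b‖ * ‖(memLp_weight_mul hg a).toLp _‖ := abs_real_inner_le_norm _ _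
    _ ≤ ‖b‖ * (normLinf Ω g * ‖a‖) := by gcongr; exact norm_weight_mul_le hg a
    _ = _ := by ring

/-- The bounded bilinear form `(a, b) ↦ ∫ g a b` on `L²(Ω)`, for `g ∈ L^∞(Ω)`. -/
noncomputable def weightedForm (g : Plane → ℝ) (hg : MemLp g ⊤ (vol Ω)) :
    L2 Ω →L[ℝ] L2 Ω →L[ℝ] ℝ :=
  LinearMap.mkContinuous₂
    (LinearMap.mk₂ ℝ (fun a b : L2 Ω => ∫ x in Ω, g x * (a x * b x))
      (fun a a' b => by
        rw [← integral_add (integrable_weight_mul hg a b) (integrable_weight_mul hg a' b)]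
        refine integral_congr_ae ?_
        filter_upwards [Lp.coeFn_add a a'] with x hx
        simp only [hx, Pi.add_apply]; ring)
      (fun c a b => by
        rw [smul_eq_mul, ← integral_const_mul]
        refine integral_congr_ae ?_
        filter_upwards [Lp.coeFn_smul c a] with x hx
        simp only [hx, Pi.smul_apply, smul_eq_mul]; ring)
      (fun a b b' => by
        rw [← integral_add (integrable_weight_mul hg a b) (integrable_weight_mul hg a b')]
        refine integral_congr_ae ?_
        filter_upwards [Lp.coeFn_add b b'] with x hx
        simp only [hx, Pi.add_apply]; ring)
      (fun c a b => by
        rw [smul_eq_mul, ← integral_const_mul]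
        refine integral_congr_ae ?_
        filter_upwards [Lp.coeFn_smul c b] with x hx
        simp only [hx, Pi.smul_apply, smul_eq_mul]; ring))
    (normLinf Ω g) (fun a b => abs_integral_weight_mul_le hg a b)

theorem weightedForm_apply {g : Plane → ℝ} (hg : MemLp g ⊤ (vol Ω)) (a b : L2 Ω) :
    weightedForm g hg a b = ∫ x in Ω, g x * (a x * b x) := rfl

theorem abs_weightedForm_le {g : Plane → ℝ} (hg : MemLp g ⊤ (vol Ω)) (a b : L2 Ω) :
    |weightedForm g hg a b| ≤ normLinf Ω g * ‖a‖ * ‖b‖ := abs_integral_weight_mul_le hg a b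

/-! ### Operators and bilinear forms on H¹₀(Ω), bounded through the gradient seminorm. -/

/-- The embedding of `H¹₀(Ω)` into `L²(Ω)`. -/
noncomputable def valL (Ω : Opens Plane) : H10 Ω →L[ℝ] L2 Ω :=
  (WithLp.fstL 2 ℝ (L2 Ω) (PiLp 2 (fun _ : Fin 2 => L2 Ω))).comp (H10 Ω).subtypeL

/-- The gradient as an operator on `H¹₀(Ω)`. -/
noncomputable def gradL (Ω : Opens Plane) : H10 Ω →L[ℝ] PiLp 2 (fun _ : Fin 2 => L2 Ω) :=
  (WithLp.sndL 2 ℝ (L2 Ω) (PiLp 2 (fun _ : Fin 2 => L2 Ω))).comp (H10 Ω).subtypeL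

/-- A weak partial derivative as an operator on `H¹₀(Ω)`. -/
noncomputable def derivL (Ω : Opens Plane) (i : Fin 2) : H10 Ω →L[ℝ] L2 Ω :=
  (PiLp.proj 2 (fun _ : Fin 2 => L2 Ω) i).comp (gradL Ω)

theorem norm_gradL (w : H10 Ω) : ‖gradL Ω w‖ = gradNorm w := rfl

theorem norm_sq_H10 (w : H10 Ω) : ‖w‖ ^ 2 = ‖valL Ω w‖ ^ 2 + gradNorm w ^ 2 :=
  WithLp.prod_norm_sq_eq_of_L2 (w : L2Pair Ω)

theorem gradNorm_sq (w : H10 Ω) :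
    gradNorm w ^ 2 = ‖derivL Ω 0 w‖ ^ 2 + ‖derivL Ω 1 w‖ ^ 2 := by
  rw [← norm_gradL, PiLp.norm_sq_eq_of_L2, Fin.sum_univ_two]; rfl

theorem gradNorm_nonneg (w : H10 Ω) : 0 ≤ gradNorm w := norm_nonneg _

theorem jet_fst (w : H10 Ω) : (jet w).1 = valL Ω w := rfl

theorem jet_snd (w : H10 Ω) (i : Fin 2) : (jet w).2 i = derivL Ω i w := rfl

/-- The form `∫ g ∇φ · ∇v`. -/
noncomputable def diffusionForm (g : Plane → ℝ) (hg : MemLp g ⊤ (vol Ω)) :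
    H10 Ω →L[ℝ] H10 Ω →L[ℝ] ℝ :=
  ∑ i, (weightedForm g hg).bilinearComp (derivL Ω i) (derivL Ω i)

/-- The form `∫ φ b · ∇v`. -/
noncomputable def convectionForm (b : Fin 2 → Plane → ℝ) (hb : ∀ i, MemLp (b i) ⊤ (vol Ω)) :
    H10 Ω →L[ℝ] H10 Ω →L[ℝ] ℝ :=
  ∑ i, (weightedForm (b i) (hb i)).bilinearComp (valL Ω) (derivL Ω i)

/-- The form `∫ φ v`. -/
noncomputable def massForm (Ω : Opens Plane) : H10 Ω →L[ℝ] H10 Ω →L[ℝ] ℝ :=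
  (innerSL ℝ (E := L2 Ω)).bilinearComp (valL Ω) (valL Ω)

theorem integrable_weight_dot {g : Plane → ℝ} (hg : MemLp g ⊤ (vol Ω)) (φ v : H10 Ω) :
    Integrable (fun x => g x * dot (jet φ).2 (jet v).2 x) (vol Ω) := by
  simp only [dot, Finset.mul_sum]
  exact integrable_finsetSum _ fun i _ => integrable_weight_mul hg (derivL Ω i φ) (derivL Ω i v)

theorem integrable_dot (φ v : H10 Ω) :
    Integrable (dot (jet φ).2 (jet v).2) (vol Ω) := by
  simpa using! integrable_weight_dot (memLp_top_const (1 : ℝ)) φ v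

theorem integrable_val_mul_dot {b : Fin 2 → Plane → ℝ} (hb : ∀ i, MemLp (b i) ⊤ (vol Ω))
    (φ v : H10 Ω) :
    Integrable (fun x => (jet φ).1 x * dot b (jet v).2 x) (vol Ω) := by
  simp only [dot, Finset.mul_sum]
  refine integrable_finsetSum _ fun i _ =>
    (integrable_weight_mul (hb i) (valL Ω φ) (derivL Ω i v)).congr
      (Eventually.of_forall fun x => ?_)
  simp only [jet_fst, jet_snd]; ring

theorem integrable_L2_mul (a b : L2 Ω) : Integrable (fun x => a x * b x) (vol Ω) := by
  simpa using! integrable_weight_mul (memLp_top_const (1 : ℝ)) a b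

theorem inner_L2_eq (a b : L2 Ω) : inner ℝ a b = ∫ x in Ω, a x * b x := by
  rw [L2.inner_def]; simp [mul_comm]

theorem diffusionForm_apply {g : Plane → ℝ} (hg : MemLp g ⊤ (vol Ω)) (φ v : H10 Ω) :
    diffusionForm g hg φ v = ∫ x in Ω, g x * dot (jet φ).2 (jet v).2 x := by
  simp only [diffusionForm, dot, Finset.mul_sum, jet_snd]
  rw [integral_finsetSum _ fun i _ => integrable_weight_mul hg (derivL Ω i φ) (derivL Ω i v)]
  simp [weightedForm_apply]

theorem convectionForm_apply {b : Fin 2 → Plane → ℝ} (hb : ∀ i, MemLp (b i) ⊤ (vol Ω))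
    (φ v : H10 Ω) :
    convectionForm b hb φ v = ∫ x in Ω, (jet φ).1 x * dot b (jet v).2 x := by
  have h : ∀ x, (jet φ).1 x * dot b (jet v).2 x
      = ∑ i, b i x * (valL Ω φ x * derivL Ω i v x) := fun x => by
    simp only [dot, Finset.mul_sum, jet_fst, jet_snd]
    exact Finset.sum_congr rfl fun i _ => by ring
  simp only [h, convectionForm]
  rw [integral_finsetSum _ fun i _ => integrable_weight_mul (hb i) (valL Ω φ) (derivL Ω i v)]
  simp [weightedForm_apply]

theorem massForm_apply (φ v : H10 Ω) :
    massForm Ω φ v = ∫ x in Ω, (jet φ).1 x * (jet v).1 x := inner_L2_eq (valL Ω φ) (valL Ω v)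

theorem abs_massForm_le (φ v : H10 Ω) : |massForm Ω φ v| ≤ ‖valL Ω φ‖ * ‖valL Ω v‖ :=
  abs_real_inner_le_norm (valL Ω φ) (valL Ω v)

/-- Hölder for each partial derivative, then Cauchy–Schwarz in ℝ² over the two components, so no
dimensional constant is lost. -/
theorem abs_diffusionForm_le {g : Plane → ℝ} (hg : MemLp g ⊤ (vol Ω)) (φ v : H10 Ω) :
    |diffusionForm g hg φ v| ≤ normLinf Ω g * gradNorm φ * gradNorm v := by
  have h0 := abs_weightedForm_le hg (derivL Ω 0 φ) (derivL Ω 0 v)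
  have h1 := abs_weightedForm_le hg (derivL Ω 1 φ) (derivL Ω 1 v)
  have hK : 0 ≤ normLinf Ω g := ENNReal.toReal_nonneg
  have hcs : ‖derivL Ω 0 φ‖ * ‖derivL Ω 0 v‖ + ‖derivL Ω 1 φ‖ * ‖derivL Ω 1 v‖
      ≤ gradNorm φ * gradNorm v := by
    refine abs_le_of_sq_le_sq' ?_ (mul_nonneg (gradNorm_nonneg _) (gradNorm_nonneg _)) |>.2
    rw [mul_pow, gradNorm_sq, gradNorm_sq]
    nlinarith [sq_nonneg (‖derivL Ω 0 φ‖ * ‖derivL Ω 1 v‖ - ‖derivL Ω 1 φ‖ * ‖derivL Ω 0 v‖)]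
  have he : diffusionForm g hg φ v = weightedForm g hg (derivL Ω 0 φ) (derivL Ω 0 v)
      + weightedForm g hg (derivL Ω 1 φ) (derivL Ω 1 v) := by
    simp [diffusionForm, Fin.sum_univ_two]
  rw [he]
  refine (abs_add_le _ _).trans ((add_le_add h0 h1).trans ?_)
  nlinarith [mul_le_mul_of_nonneg_left hcs hK]

/-- The factor √2 is the price of the componentwise maximum in `normLinfVec`: s + t ≤ √2 (s² +
t²)^{1/2} for the norms of the two partial derivatives. -/
theorem abs_convectionForm_le {b : Fin 2 → Plane → ℝ} (hb : ∀ i, MemLp (b i) ⊤ (vol Ω))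
    (φ v : H10 Ω) :
    |convectionForm b hb φ v| ≤ √2 * normLinfVec Ω b * ‖valL Ω φ‖ * gradNorm v := by
  have h0 := abs_weightedForm_le (hb 0) (valL Ω φ) (derivL Ω 0 v)
  have h1 := abs_weightedForm_le (hb 1) (valL Ω φ) (derivL Ω 1 v)
  have hK0 : normLinf Ω (b 0) ≤ normLinfVec Ω b := le_max_left _ _
  have hK1 : normLinf Ω (b 1) ≤ normLinfVec Ω b := le_max_right _ _
  have hK : 0 ≤ normLinfVec Ω b := ENNReal.toReal_nonneg.trans hK0
  have hs : ‖derivL Ω 0 v‖ + ‖derivL Ω 1 v‖ ≤ √2 * gradNorm v := by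
    refine abs_le_of_sq_le_sq' ?_ (mul_nonneg (by positivity) (gradNorm_nonneg _)) |>.2
    rw [mul_pow, gradNorm_sq, Real.sq_sqrt (by norm_num)]
    nlinarith [sq_nonneg (‖derivL Ω 0 v‖ - ‖derivL Ω 1 v‖)]
  have he : convectionForm b hb φ v = weightedForm (b 0) (hb 0) (valL Ω φ) (derivL Ω 0 v)
      + weightedForm (b 1) (hb 1) (valL Ω φ) (derivL Ω 1 v) := by
    simp [convectionForm, Fin.sum_univ_two]
  rw [he]
  refine (abs_add_le _ _).trans ((add_le_add h0 h1).trans ?_)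
  calc _ ≤ normLinfVec Ω b * ‖valL Ω φ‖ * ‖derivL Ω 0 v‖
        + normLinfVec Ω b * ‖valL Ω φ‖ * ‖derivL Ω 1 v‖ := by gcongr
    _ = normLinfVec Ω b * ‖valL Ω φ‖ * (‖derivL Ω 0 v‖ + ‖derivL Ω 1 v‖) := by ring
    _ ≤ normLinfVec Ω b * ‖valL Ω φ‖ * (√2 * gradNorm v) := by gcongr
    _ = _ := by ring

/-- The Dirichlet form `∫ ∇φ · ∇v`. -/
noncomputable def dirichletForm (Ω : Opens Plane) : H10 Ω →L[ℝ] H10 Ω →L[ℝ] ℝ :=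
  diffusionForm (fun _ => 1) (memLp_top_const (1 : ℝ))

theorem dirichletForm_apply (φ v : H10 Ω) :
    dirichletForm Ω φ v = ∫ x in Ω, dot (jet φ).2 (jet v).2 x := by
  simp [dirichletForm, diffusionForm_apply]

theorem dirichletForm_eq_inner (φ v : H10 Ω) :
    dirichletForm Ω φ v = inner ℝ (gradL Ω φ) (gradL Ω v) := by
  rw [PiLp.inner_apply]
  simp only [dirichletForm, diffusionForm, sum_apply,
    ContinuousLinearMap.bilinearComp_apply, weightedForm_apply, one_mul]
  exact Finset.sum_congr rfl fun i _ => (inner_L2_eq _ _).symm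

theorem dirichletForm_self (φ : H10 Ω) : dirichletForm Ω φ φ = gradNorm φ ^ 2 := by
  rw [dirichletForm_eq_inner, real_inner_self_eq_norm_sq, norm_gradL]

theorem abs_dirichletForm_le (φ v : H10 Ω) :
    |dirichletForm Ω φ v| ≤ gradNorm φ * gradNorm v := by
  rw [dirichletForm_eq_inner]; exact abs_real_inner_le_norm _ _

/-! ### Poincaré inequality. -/

theorem partialDeriv_add (η ζ : 𝓓(Ω, ℝ)) (i : Fin 2) :
    partialDeriv i (⇑η + ⇑ζ) = partialDeriv i η + partialDeriv i ζ := by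
  ext x
  have h1 : DifferentiableAt ℝ η x := η.contDiff.differentiable (by simp) x
  have h2 : DifferentiableAt ℝ ζ x := ζ.contDiff.differentiable (by simp) x
  simp [partialDeriv, fderiv_add h1 h2]

theorem partialDeriv_smul (c : ℝ) (η : 𝓓(Ω, ℝ)) (i : Fin 2) :
    partialDeriv i (c • ⇑η) = c • partialDeriv i η := by
  ext x
  have h1 : DifferentiableAt ℝ η x := η.contDiff.differentiable (by simp) x
  simp [partialDeriv, fderiv_const_smul h1]

/-- `η ↦ (η, ∇η)` as a linear map. -/
noncomputable def testPairL (Ω : Opens Plane) : 𝓓(Ω, ℝ) →ₗ[ℝ] L2Pair Ω where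
  toFun := testPair
  map_add' η ζ := by
    refine WithLp.ofLp_injective 2 (Prod.ext ?_ (WithLp.ofLp_injective 2 (funext fun i => ?_)))
    · exact (testFunction_memLp η).toLp_add (testFunction_memLp ζ)
    · refine Eq.trans ?_
        ((testFunction_partialDeriv_memLp η i).toLp_add (testFunction_partialDeriv_memLp ζ i))
      simp [testPair, partialDeriv_add]
  map_smul' c η := by
    refine WithLp.ofLp_injective 2 (Prod.ext ?_ (WithLp.ofLp_injective 2 (funext fun i => ?_)))
    · exact (testFunction_memLp η).toLp_const_smul c
    · refine Eq.trans ?_ ((testFunction_partialDeriv_memLp η i).toLp_const_smul c)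
      simp [testPair, partialDeriv_smul]

theorem norm_fderiv_le_sum_partialDeriv (η : Plane → ℝ) (x : Plane) :
    ‖fderiv ℝ η x‖ ≤ ‖partialDeriv 0 η x‖ + ‖partialDeriv 1 η x‖ := by
  refine ContinuousLinearMap.opNorm_le_bound _ (by positivity) fun y => ?_
  have hy : y = y 0 • EuclideanSpace.single 0 (1 : ℝ) + y 1 • EuclideanSpace.single 1 (1 : ℝ) := by
    ext i; fin_cases i <;> simp
  have h0 : ‖y 0‖ ≤ ‖y‖ := PiLp.norm_apply_le y 0
  have h1 : ‖y 1‖ ≤ ‖y‖ := PiLp.norm_apply_le y 1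
  have he : fderiv ℝ η x y = y 0 * partialDeriv 0 η x + y 1 * partialDeriv 1 η x := by
    conv_lhs => rw [hy]
    simp [partialDeriv]
  rw [he]
  calc _ ≤ ‖y 0‖ * ‖partialDeriv 0 η x‖ + ‖y 1‖ * ‖partialDeriv 1 η x‖ := by
        simpa only [norm_mul] using norm_add_le (y 0 * partialDeriv 0 η x) (y 1 * partialDeriv 1 η x)
    _ ≤ ‖y‖ * ‖partialDeriv 0 η x‖ + ‖y‖ * ‖partialDeriv 1 η x‖ := by gcongr
    _ = _ := by ring

theorem continuous_partialDeriv (η : 𝓓(Ω, ℝ)) (i : Fin 2) : Continuous (partialDeriv i η) :=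
  (η.contDiff.continuous_fderiv (by simp)).clm_apply continuous_const

theorem support_partialDeriv_subset (η : 𝓓(Ω, ℝ)) (i : Fin 2) :
    Function.support (partialDeriv i η) ⊆ Ω := fun x hx =>
  η.tsupport_subset (support_fderiv_subset ℝ (f := η) fun h => hx (by simp [partialDeriv, h]))

/-- Hölder against the constant 1; the integral over the plane reduces to Ω because the support lies
in Ω. -/
theorem eLpNorm_one_partialDeriv_le (η : 𝓓(Ω, ℝ)) (i : Fin 2) :
    eLpNorm (partialDeriv i η) 1 volume
      ≤ eLpNorm (partialDeriv i η) 2 (vol Ω) * volume (Ω : Set Plane) ^ (1 / 2 : ℝ) := by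
  rw [← eLpNorm_restrict_eq_of_support_subset (support_partialDeriv_subset η i)]
  have h := eLpNorm_le_eLpNorm_mul_rpow_measure_univ (p := 1) (q := 2) (μ := vol Ω)
    (by norm_num) (continuous_partialDeriv η i).aestronglyMeasurable
  convert h using 3
  · simp
  · norm_num

/-- The Poincaré inequality for test functions on a bounded open set. -/
theorem exists_poincare_testFunction (hΩ : Bornology.IsBounded (Ω : Set Plane)) :
    ∃ C : ℝ, 0 < C ∧ ∀ η : 𝓓(Ω, ℝ), ‖(testPair η).fst‖ ≤ C * ‖(testPair η).snd‖ := by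
  have hvol : volume (Ω : Set Plane) ^ (1 / 2 : ℝ) ≠ ⊤ :=
    ENNReal.rpow_ne_top_of_nonneg (by norm_num) hΩ.measure_lt_top.ne
  set V : ℝ≥0∞ := volume (Ω : Set Plane) ^ (1 / 2 : ℝ)
  set S := eLpNormLESNormFDerivOfLeConst ℝ (volume : Measure Plane) (Ω : Set Plane) 1 2
  -- Two partial derivatives each contribute S|Ω|^{1/2}; the added 1 only makes the constant
  -- positive.
  refine ⟨2 * S * V.toReal + 1, by positivity, fun η => ?_⟩
  -- Gagliardo–Nirenberg–Sobolev in the plane: 2 is the Sobolev conjugate of 1.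
  have hGNS : eLpNorm η 2 volume ≤ S * eLpNorm (fderiv ℝ η) 1 volume := by
    refine eLpNorm_le_eLpNorm_fderiv_of_le volume (p := 1) (q := 2) (F := ℝ)
      (η.contDiff.of_le (by simp)) ((subset_tsupport _).trans η.tsupport_subset) le_rfl ?_ ?_ hΩ
    · simp
    · simp; norm_num
  have hfd : eLpNorm (fderiv ℝ η) 1 volume
      ≤ eLpNorm (partialDeriv 0 η) 1 volume + eLpNorm (partialDeriv 1 η) 1 volume := by
    have hm := fun i => (continuous_partialDeriv η i).norm.aestronglyMeasurable (μ := volume)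
    refine (eLpNorm_mono_real (norm_fderiv_le_sum_partialDeriv η)).trans
      ((eLpNorm_add_le (hm 0) (hm 1) le_rfl).trans ?_)
    simp only [eLpNorm_norm]; exact le_rfl
  have hd : ∀ i, eLpNorm (partialDeriv i η) 2 (vol Ω)
      ≤ ENNReal.ofReal ‖(testPair η).snd‖ := fun i => by
    have h1 : ‖(testFunction_partialDeriv_memLp η i).toLp (partialDeriv i η)‖
        ≤ ‖(testPair η).snd‖ := PiLp.norm_apply_le (testPair η).snd i
    rw [Lp.norm_toLp] at h1
    exact (ENNReal.le_ofReal_iff_toReal_le (testFunction_partialDeriv_memLp η i).eLpNorm_ne_top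
      (norm_nonneg _)).2 h1
  have hmain : eLpNorm η 2 (vol Ω)
      ≤ S * (ENNReal.ofReal ‖(testPair η).snd‖ * V + ENNReal.ofReal ‖(testPair η).snd‖ * V) := by
    refine (eLpNorm_mono_measure _ Measure.restrict_le_self).trans (hGNS.trans ?_)
    refine mul_le_mul_right (hfd.trans (add_le_add ?_ ?_)) _
    · exact (eLpNorm_one_partialDeriv_le η 0).trans (mul_le_mul_left (hd 0) _)
    · exact (eLpNorm_one_partialDeriv_le η 1).trans (mul_le_mul_left (hd 1) _)
  have hfst : ‖(testPair η).fst‖ = (eLpNorm η 2 (vol Ω)).toReal :=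
    Lp.norm_toLp _ (testFunction_memLp η)
  have hfin : ENNReal.ofReal ‖(testPair η).snd‖ * V ≠ ⊤ :=
    ENNReal.mul_ne_top ENNReal.ofReal_ne_top hvol
  have := ENNReal.toReal_mono
    (ENNReal.mul_ne_top ENNReal.coe_ne_top (ENNReal.add_ne_top.2 ⟨hfin, hfin⟩)) hmain
  rw [ENNReal.toReal_mul, ENNReal.toReal_add hfin hfin, ENNReal.toReal_mul,
    ENNReal.toReal_ofReal (norm_nonneg _), ENNReal.coe_toReal] at this
  rw [hfst]
  nlinarith [norm_nonneg (testPair η).snd]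

/-- The Poincaré inequality in `H¹₀(Ω)`. -/
theorem exists_poincare (hΩ : Bornology.IsBounded (Ω : Set Plane)) :
    ∃ C : ℝ, 0 < C ∧ ∀ w : H10 Ω, ‖(w : L2Pair Ω).fst‖ ≤ C * gradNorm w := by
  obtain ⟨C, hC, h⟩ := exists_poincare_testFunction hΩ
  refine ⟨C, hC, fun w => ?_⟩
  -- The inequality is a closed condition on pairs, so it passes from test functions to their
  -- closure.
  have hclosed : IsClosed {z : L2Pair Ω | ‖z.fst‖ ≤ C * ‖z.snd‖} :=
    isClosed_le (WithLp.fstL 2 ℝ (L2 Ω) (PiLp 2 (fun _ : Fin 2 => L2 Ω))).continuous.norm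
      ((WithLp.sndL 2 ℝ (L2 Ω) (PiLp 2 (fun _ : Fin 2 => L2 Ω))).continuous.norm.const_mul C)
  refine closure_minimal ?_ hclosed w.2
  -- Test pairs already form a subspace, so every element of the span comes from a single test
  -- function.
  have hspan : Submodule.span ℝ (Set.range (testPair (Ω := Ω))) ≤ LinearMap.range (testPairL Ω) :=
    Submodule.span_le.2 (by rintro _ ⟨η, rfl⟩; exact ⟨η, rfl⟩)
  intro z hz
  obtain ⟨η, rfl⟩ := hspan hz
  exact h η

/-! ### Lax–Milgram, and admissible constants as Poincaré constants. -/

/-- The Lax–Milgram theorem, in the form in which the trial and the test space are related by a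
surjective operator `S`. -/
theorem existsUnique_of_coercive {V : Type*} [NormedAddCommGroup V] [InnerProductSpace ℝ V]
    [CompleteSpace V] (B : V →L[ℝ] V →L[ℝ] ℝ) (S : V →L[ℝ] V) (hS : Function.Surjective S)
    {c : ℝ} (hc : 0 < c) (hB : ∀ v, c * ‖v‖ ^ 2 ≤ B v (S v)) (l : V →L[ℝ] ℝ) :
    ∃! u : V, ∀ v, B u v = l v := by
  have hco : IsCoercive (B.bilinearComp (ContinuousLinearMap.id ℝ V) S) :=
    ⟨c, hc, fun v => by simpa [pow_two, mul_assoc] using hB v⟩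
  set e := hco.continuousLinearEquivOfBilin
  set r := (InnerProductSpace.toDual ℝ V).symm (l.comp S)
  have hr : ∀ v, inner ℝ r v = l (S v) := fun v => by simp [r]
  have he : ∀ u v, inner ℝ (e u) v = B u (S v) := fun u v => by
    simp [e, hco.continuousLinearEquivOfBilin_apply]
  -- Surjectivity of S is needed for existence only: it turns validity for all Sv into validity for
  -- all v. Uniqueness uses the vectors Sv alone.
  refine ⟨e.symm r, fun v => ?_, fun u hu => ?_⟩
  · obtain ⟨v, rfl⟩ := hS v
    rw [← he, ← hr, e.apply_symm_apply]
  · rw [e.eq_symm_apply]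
    exact ext_inner_right ℝ fun v => by rw [he, hr, hu]

instance : CompleteSpace (H10 Ω) :=
  (Submodule.isClosed_topologicalClosure _).completeSpace_coe

theorem norm_sq_le_of_poincare {C : ℝ} (hC : ∀ w : H10 Ω, ‖valL Ω w‖ ≤ C * gradNorm w)
    (w : H10 Ω) : ‖w‖ ^ 2 ≤ (1 + C ^ 2) * gradNorm w ^ 2 := by
  rw [norm_sq_H10]
  have := pow_le_pow_left₀ (norm_nonneg _) (hC w) 2
  rw [mul_pow] at this
  linarith

/-- Testing with u itself gives |u|₁² = ∫ f u ≤ C ‖f‖ |u|₁; cancel one factor |u|₁. -/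
theorem isPoissonConstant_of_poincare {C : ℝ} (h0 : 0 < C)
    (hC : ∀ w : H10 Ω, ‖valL Ω w‖ ≤ C * gradNorm w) : IsPoissonConstant Ω C := by
  refine ⟨h0, fun f u hu => ?_⟩
  have h := hu u
  rw [← dirichletForm_apply, dirichletForm_self, jet_fst, ← inner_L2_eq] at h
  have h1 : gradNorm u * gradNorm u ≤ C * ‖f‖ * gradNorm u := by
    calc _ = inner ℝ f (valL Ω u) := by rw [← h, sq]
      _ ≤ ‖f‖ * ‖valL Ω u‖ := real_inner_le_norm _ _
      _ ≤ ‖f‖ * (C * gradNorm u) := by gcongr; exact hC u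
      _ = _ := by ring
  rcases (gradNorm_nonneg u).eq_or_lt with h2 | h2
  · rw [← h2]; positivity
  · exact le_of_mul_le_mul_right h1 h2

/-- The functional `v ↦ ∫ f v` on `H¹₀(Ω)`. -/
noncomputable def pairingL (f : L2 Ω) : H10 Ω →L[ℝ] ℝ :=
  (innerSL ℝ (E := L2 Ω) f : L2 Ω →L[ℝ] ℝ).comp (valL Ω)

theorem pairingL_apply (f : L2 Ω) (v : H10 Ω) : pairingL f v = ∫ x in Ω, f x * (jet v).1 x :=
  inner_L2_eq f (valL Ω v)

theorem exists_poissonSolution (hΩ : Bornology.IsBounded (Ω : Set Plane)) (f : L2 Ω) :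
    ∃ u : H10 Ω, IsPoissonSolution f u := by
  obtain ⟨C, -, hC⟩ := exists_poincare hΩ
  have hcoer : ∀ v : H10 Ω, (1 + C ^ 2)⁻¹ * ‖v‖ ^ 2
      ≤ dirichletForm Ω v (ContinuousLinearMap.id ℝ (H10 Ω) v) := fun v => by
    rw [ContinuousLinearMap.id_apply, dirichletForm_self, inv_mul_le_iff₀ (by positivity)]
    exact norm_sq_le_of_poincare hC v
  obtain ⟨u, hu, -⟩ := existsUnique_of_coercive (V := H10 Ω) (dirichletForm Ω)
    (ContinuousLinearMap.id ℝ (H10 Ω)) Function.surjective_id (by positivity) hcoer (pairingL f)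
  refine ⟨u, fun v => ?_⟩
  rw [← dirichletForm_apply, hu v, pairingL_apply]

/-- An admissible constant for the Poisson problem is a constant in the Poincaré inequality. -/
theorem IsPoissonConstant.poincare (hΩ : Bornology.IsBounded (Ω : Set Plane)) {C : ℝ}
    (h : IsPoissonConstant Ω C) (w : H10 Ω) : ‖valL Ω w‖ ≤ C * gradNorm w := by
  -- Duality: solve -Δu = w and test with w, so that ‖w‖² = ∫ ∇u · ∇w ≤ C ‖w‖ |w|₁.
  obtain ⟨u, hu⟩ := exists_poissonSolution hΩ (valL Ω w)
  have h1 := h.2 _ u hu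
  have h2 := hu w
  rw [← dirichletForm_apply, jet_fst, ← inner_L2_eq, real_inner_self_eq_norm_sq] at h2
  have h3 : ‖valL Ω w‖ * ‖valL Ω w‖ ≤ C * gradNorm w * ‖valL Ω w‖ := by
    calc _ = dirichletForm Ω u w := by rw [h2, sq]
      _ ≤ gradNorm u * gradNorm w := (le_abs_self _).trans (abs_dirichletForm_le u w)
      _ ≤ C * ‖valL Ω w‖ * gradNorm w := by gcongr; exact gradNorm_nonneg w
      _ = _ := by ring
  rcases (norm_nonneg (valL Ω w)).eq_or_lt with h4 | h4
  · rw [← h4]; exact mul_nonneg h.1.le (gradNorm_nonneg w)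
  · exact le_of_mul_le_mul_right h3 h4

/-! ### Coercivity of the three-component system. -/

/-- On the line X = Y the form is 2AX² + βZ² - 4NXZ, so the hypothesis is exactly positive
definiteness. -/
theorem exists_coercivity_constant {A β N : ℝ} (hβ : 0 < β)
    (h : 2 * N ^ 2 < A * β) :
    ∃ c > 0, ∀ X Y Z : ℝ,
      c * (X ^ 2 + Y ^ 2 + Z ^ 2) ≤ A * (X ^ 2 + Y ^ 2) + β * Z ^ 2 - 2 * N * Z * (X + Y) := by
  have h1 : 2 * N ^ 2 / β < A := by rwa [div_lt_iff₀ hβ]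
  have h0 : 0 ≤ 2 * N ^ 2 / β := by positivity
  -- Young's inequality with weight A' absorbs both cross terms; A' slightly below A leaves a
  -- positive multiple of X² + Y² as well as of Z².
  obtain ⟨A', h2, h3⟩ := exists_between h1
  have hA' : 0 < A' := h0.trans_lt h2
  have h4 : 2 * N ^ 2 / A' < β := by
    rw [div_lt_iff₀ hβ] at h2
    rw [div_lt_iff₀ hA']; linarith
  refine ⟨min (A - A') (β - 2 * N ^ 2 / A'), lt_min (by linarith) (by linarith),
    fun X Y Z => ?_⟩
  have key : ∀ X : ℝ, 2 * N * Z * X ≤ A' * X ^ 2 + N ^ 2 / A' * Z ^ 2 := fun X => by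
    have : 0 ≤ (A' * X - N * Z) ^ 2 / A' := by positivity
    have he : (A' * X - N * Z) ^ 2 / A' = A' * X ^ 2 + N ^ 2 / A' * Z ^ 2 - 2 * N * Z * X := by
      field_simp; ring
    linarith
  have hm1 := mul_le_mul_of_nonneg_right (min_le_left (A - A') (β - 2 * N ^ 2 / A'))
    (by positivity : 0 ≤ X ^ 2 + Y ^ 2)
  have hm2 := mul_le_mul_of_nonneg_right (min_le_right (A - A') (β - 2 * N ^ 2 / A'))
    (sq_nonneg Z)
  have e : 2 * N ^ 2 / A' * Z ^ 2 = N ^ 2 / A' * Z ^ 2 + N ^ 2 / A' * Z ^ 2 := by ring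
  linarith [key X, key Y]

section Triple

variable {H : Type*} [NormedAddCommGroup H] [InnerProductSpace ℝ H]

/-- The `k`-th component of an element of `H³`. -/
noncomputable def compL (H : Type*) [NormedAddCommGroup H] [InnerProductSpace ℝ H] (k : Fin 3) :
    PiLp 2 (fun _ : Fin 3 => H) →L[ℝ] H :=
  PiLp.proj 2 (fun _ : Fin 3 => H) k

/-- The form `D(φ₁, v₁) + P(φ₃, v₁) + T(φ₁, v₁) + D(φ₂, v₂) - Q(φ₃, v₂) - T(φ₂, v₂) + ε D(φ₃, v₃)
- M(φ₁, v₃) + M(φ₂, v₃)` on `H³`. -/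
noncomputable def tripleForm (ε : ℝ) (D P Q T M : H →L[ℝ] H →L[ℝ] ℝ) :
    PiLp 2 (fun _ : Fin 3 => H) →L[ℝ] PiLp 2 (fun _ : Fin 3 => H) →L[ℝ] ℝ :=
  D.bilinearComp (compL H 0) (compL H 0) + P.bilinearComp (compL H 2) (compL H 0)
    + T.bilinearComp (compL H 0) (compL H 0) + D.bilinearComp (compL H 1) (compL H 1)
    - Q.bilinearComp (compL H 2) (compL H 1) - T.bilinearComp (compL H 1) (compL H 1)
    + ε • D.bilinearComp (compL H 2) (compL H 2) - M.bilinearComp (compL H 0) (compL H 2)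
    + M.bilinearComp (compL H 1) (compL H 2)

theorem tripleForm_toLp (ε : ℝ) (D P Q T M : H →L[ℝ] H →L[ℝ] ℝ) (φ v : Fin 3 → H) :
    tripleForm ε D P Q T M (WithLp.toLp 2 φ) (WithLp.toLp 2 v)
      = D (φ 0) (v 0) + P (φ 2) (v 0) + T (φ 0) (v 0) + D (φ 1) (v 1) - Q (φ 2) (v 1)
        - T (φ 1) (v 1) + ε * D (φ 2) (v 2) - M (φ 0) (v 2) + M (φ 1) (v 2) := rfl

/-- The operator `(v₁, v₂, v₃) ↦ (v₁, v₂, α v₃)` on `H³`. -/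
noncomputable def scaleLast (H : Type*) [NormedAddCommGroup H] [InnerProductSpace ℝ H] (α : ℝ) :
    PiLp 2 (fun _ : Fin 3 => H) →L[ℝ] PiLp 2 (fun _ : Fin 3 => H) :=
  (PiLp.continuousLinearEquiv 2 ℝ (fun _ : Fin 3 => H)).symm.toContinuousLinearMap.comp
    (ContinuousLinearMap.pi ![compL H 0, compL H 1, α • compL H 2])

theorem scaleLast_toLp (α : ℝ) (v : Fin 3 → H) :
    scaleLast H α (WithLp.toLp 2 v) = WithLp.toLp 2 ![v 0, v 1, α • v 2] := by
  refine WithLp.ofLp_injective 2 (funext fun k => ?_)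
  fin_cases k <;> rfl

theorem scaleLast_surjective {α : ℝ} (hα : α ≠ 0) : Function.Surjective (scaleLast H α) := by
  intro w
  refine ⟨WithLp.toLp 2 ![w 0, w 1, α⁻¹ • w 2], ?_⟩
  rw [scaleLast_toLp]
  refine WithLp.ofLp_injective 2 (funext fun k => ?_)
  fin_cases k <;> simp [hα]

/-- Scaling the last test component multiplies the mass terms by α. With αm = N they are bounded
like the P and Q terms, and together they give the factor 2N. -/
theorem tripleForm_scaleLast_ge (ε : ℝ) {D P Q T M : H →L[ℝ] H →L[ℝ] ℝ} {g : H → ℝ}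
    (hD : ∀ w, D w w = g w ^ 2) {N θ m α : ℝ}
    (hP : ∀ φ v, |P φ v| ≤ N * g φ * g v) (hQ : ∀ φ v, |Q φ v| ≤ N * g φ * g v)
    (hT : ∀ w, |T w w| ≤ θ * g w ^ 2) (hM : ∀ φ v, |M φ v| ≤ m * g φ * g v)
    (hα : 0 ≤ α) (hαN : α * m = N) (φ : Fin 3 → H) :
    (1 - θ) * (g (φ 0) ^ 2 + g (φ 1) ^ 2) + α * ε * g (φ 2) ^ 2
        - 2 * N * g (φ 2) * (g (φ 0) + g (φ 1))
      ≤ tripleForm ε D P Q T M (WithLp.toLp 2 φ) (scaleLast H α (WithLp.toLp 2 φ)) := by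
  have hmass : ∀ k, α * |M (φ k) (φ 2)| ≤ N * g (φ k) * g (φ 2) := fun k =>
    calc _ ≤ α * (m * g (φ k) * g (φ 2)) := mul_le_mul_of_nonneg_left (hM _ _) hα
      _ = (α * m) * g (φ k) * g (φ 2) := by ring
      _ = _ := by rw [hαN]
  have hm0 := mul_le_mul_of_nonneg_left (le_abs_self (M (φ 0) (φ 2))) hα
  have hm1 := mul_le_mul_of_nonneg_left (neg_le_abs (M (φ 1) (φ 2))) hα
  rw [scaleLast_toLp, tripleForm_toLp]
  simp only [Matrix.cons_val_zero, Matrix.cons_val_one, Matrix.cons_val, map_smul, smul_eq_mul, hD]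
  linarith [neg_le_of_abs_le (hP (φ 2) (φ 0)), le_of_abs_le (hQ (φ 2) (φ 1)),
    neg_le_of_abs_le (hT (φ 0)), le_of_abs_le (hT (φ 1)), hmass 0, hmass 1]

theorem exists_tripleForm_coercive {ε : ℝ} (hε : 0 < ε) {D P Q T M : H →L[ℝ] H →L[ℝ] ℝ}
    {g : H → ℝ} (hg : ∀ w, 0 ≤ g w) {κ : ℝ} (hκ : 0 < κ) (hnorm : ∀ w, ‖w‖ ^ 2 ≤ κ * g w ^ 2)
    (hD : ∀ w, D w w = g w ^ 2) {N₀ θ m : ℝ} (hN₀ : 0 ≤ N₀) (hm : 0 < m)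
    (hP : ∀ φ v, |P φ v| ≤ N₀ * g φ * g v) (hQ : ∀ φ v, |Q φ v| ≤ N₀ * g φ * g v)
    (hT : ∀ w, |T w w| ≤ θ * g w ^ 2) (hM : ∀ φ v, |M φ v| ≤ m * g φ * g v)
    (hsmall : θ + 2 * N₀ * m / ε < 1) :
    ∃ α ≠ 0, ∃ c > 0, ∀ φ : PiLp 2 (fun _ : Fin 3 => H),
      c * ‖φ‖ ^ 2 ≤ tripleForm ε D P Q T M φ (scaleLast H α φ) := by
  -- N is taken strictly above N₀, which may vanish (p = n = 0), so that α = N/m is nonzero and the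
  -- scaling stays surjective. The upper bound is 2Nm < (1 - θ)ε.
  obtain ⟨N, hNN, hN⟩ : ∃ N, N₀ < N ∧ N < (1 - θ) * ε / (2 * m) := exists_between (by
    have : 2 * N₀ * m / ε < 1 - θ := by linarith
    rw [div_lt_iff₀ hε] at this
    rw [lt_div_iff₀ (by positivity)]; linarith)
  have hN0 : 0 < N := hN₀.trans_lt hNN
  rw [lt_div_iff₀ (by positivity)] at hN
  obtain ⟨α, hα⟩ : ∃ α, α = N / m := ⟨_, rfl⟩
  have hαpos : 0 < α := by rw [hα]; positivity
  have hαN : α * m = N := by rw [hα]; field_simp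
  obtain ⟨c, hc, hcoer⟩ := exists_coercivity_constant (A := 1 - θ) (β := α * ε) (N := N)
    -- With β = αε = Nε/m, the condition 2N² < (1 - θ)β is N times the upper bound on N, divided by
    -- m.
    (by positivity) (by
      rw [hα, show (1 - θ) * (N / m * ε) = N * ((1 - θ) * ε) / m by ring, lt_div_iff₀ hm]
      linarith [mul_lt_mul_of_pos_left hN hN0])
  have hmono : ∀ φ v, N₀ * g φ * g v ≤ N * g φ * g v := fun φ v =>
    mul_le_mul_of_nonneg_right (mul_le_mul_of_nonneg_right hNN.le (hg φ)) (hg v)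
  refine ⟨α, hαpos.ne', c / κ, by positivity, fun φ => ?_⟩
  have h1 := tripleForm_scaleLast_ge ε hD (fun φ v => (hP φ v).trans (hmono φ v))
    (fun φ v => (hQ φ v).trans (hmono φ v)) hT hM hαpos.le hαN φ.ofLp
  refine le_trans ?_ ((hcoer _ _ _).trans h1)
  rw [PiLp.norm_sq_eq_of_L2, Fin.sum_univ_three, div_mul_eq_mul_div, div_le_iff₀ hκ, mul_assoc]
  refine mul_le_mul_of_nonneg_left ?_ hc.le
  linarith [hnorm (φ 0), hnorm (φ 1), hnorm (φ 2)]

/-- Lax–Milgram is applied in the Hilbert sum `PiLp 2`, and the answer is carried back to plain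
triples. -/
theorem existsUnique_tripleForm [CompleteSpace H] {ε : ℝ} (hε : 0 < ε)
    {D P Q T M : H →L[ℝ] H →L[ℝ] ℝ} {g : H → ℝ} (hg : ∀ w, 0 ≤ g w) {κ : ℝ} (hκ : 0 < κ)
    (hnorm : ∀ w, ‖w‖ ^ 2 ≤ κ * g w ^ 2) (hD : ∀ w, D w w = g w ^ 2) {N₀ θ m : ℝ} (hN₀ : 0 ≤ N₀)
    (hm : 0 < m) (hP : ∀ φ v, |P φ v| ≤ N₀ * g φ * g v) (hQ : ∀ φ v, |Q φ v| ≤ N₀ * g φ * g v)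
    (hT : ∀ w, |T w w| ≤ θ * g w ^ 2) (hM : ∀ φ v, |M φ v| ≤ m * g φ * g v)
    (hsmall : θ + 2 * N₀ * m / ε < 1) (l : Fin 3 → H →L[ℝ] ℝ) :
    ∃! φ : Fin 3 → H, ∀ v : Fin 3 → H,
      D (φ 0) (v 0) + P (φ 2) (v 0) + T (φ 0) (v 0) + D (φ 1) (v 1) - Q (φ 2) (v 1)
        - T (φ 1) (v 1) + ε * D (φ 2) (v 2) - M (φ 0) (v 2) + M (φ 1) (v 2)
      = ∑ k, l k (v k) := by
  obtain ⟨α, hα, c, hc, hcoer⟩ :=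
    exists_tripleForm_coercive hε hg hκ hnorm hD hN₀ hm hP hQ hT hM hsmall
  have hl : ∀ v : Fin 3 → H, (∑ k, (l k).comp (compL H k)) (WithLp.toLp 2 v) = ∑ k, l k (v k) :=
    fun v => by rw [sum_apply]; rfl
  obtain ⟨φ, hφ, huniq⟩ := existsUnique_of_coercive (tripleForm ε D P Q T M) (scaleLast H α)
    (scaleLast_surjective hα) hc hcoer (∑ k, (l k).comp (compL H k))
  refine ⟨φ.ofLp, fun v => ?_, fun φ' hφ' => ?_⟩
  · rw [← hl, ← tripleForm_toLp]
    exact hφ _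
  · refine congrArg WithLp.ofLp (huniq (WithLp.toLp 2 φ') fun v => ?_)
    rw [← WithLp.toLp_ofLp 2 v, tripleForm_toLp, hl]
    exact hφ' _

end Triple

/-! ### The linearized Poisson–Nernst–Planck problem. -/

theorem linearizedForm_jets (ε : ℝ) {p n : Plane → ℝ} {b : Fin 2 → Plane → ℝ}
    (hp : MemLp p ⊤ (vol Ω)) (hn : MemLp n ⊤ (vol Ω)) (hb : ∀ i, MemLp (b i) ⊤ (vol Ω))
    (φ v : Fin 3 → H10 Ω) :
    linearizedForm Ω ε p n b (jets φ) (jets v)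
      = dirichletForm Ω (φ 0) (v 0) + diffusionForm p hp (φ 2) (v 0)
        + convectionForm b hb (φ 0) (v 0) + dirichletForm Ω (φ 1) (v 1)
        - diffusionForm n hn (φ 2) (v 1) - convectionForm b hb (φ 1) (v 1)
        + ε * dirichletForm Ω (φ 2) (v 2) - massForm Ω (φ 0) (v 2) + massForm Ω (φ 1) (v 2) := by
  have i1 := integrable_dot (φ 0) (v 0)
  have i2 := integrable_weight_dot hp (φ 2) (v 0)
  have i3 := integrable_val_mul_dot hb (φ 0) (v 0)
  have i4 := integrable_dot (φ 1) (v 1)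
  have i5 := integrable_weight_dot hn (φ 2) (v 1)
  have i6 := integrable_val_mul_dot hb (φ 1) (v 1)
  have i7 := (integrable_dot (φ 2) (v 2)).const_mul ε
  have i8 : Integrable (fun x => (jet (φ 0)).1 x * (jet (v 2)).1 x) (vol Ω) :=
    integrable_L2_mul (valL Ω (φ 0)) (valL Ω (v 2))
  have i9 : Integrable (fun x => (jet (φ 1)).1 x * (jet (v 2)).1 x) (vol Ω) :=
    integrable_L2_mul (valL Ω (φ 1)) (valL Ω (v 2))
  simp only [dirichletForm_apply, diffusionForm_apply, convectionForm_apply, massForm_apply,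
    linearizedForm, jets]
  have j2 := i1.add i2
  have j3 := j2.add i3
  have j4 := j3.add i4
  have j5 := j4.sub i5
  have j6 := j5.sub i6
  have j7 := j6.add i7
  have j8 := j7.sub i8
  refine (integral_add j8 i9).trans ?_
  rw [integral_sub' j7 i8, integral_add' j6 i7, integral_sub' j5 i6, integral_sub' j4 i5,
    integral_add' j3 i4, integral_add' j2 i3, integral_add' i1 i2, integral_const_mul]

/-- The abstract system applies with θ = √2 ‖b‖ C, N₀ = max(‖p‖, ‖n‖) and m = C²: the mass form
costs one Poincaré constant for each argument, the convection form only one. -/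
theorem existsUnique_linearizedSolution {ε : ℝ} (hε : 0 < ε) {p n : Plane → ℝ}
    {b : Fin 2 → Plane → ℝ} (hp : MemLp p ⊤ (vol Ω)) (hn : MemLp n ⊤ (vol Ω))
    (hb : ∀ i, MemLp (b i) ⊤ (vol Ω)) {C : ℝ} (hC0 : 0 < C)
    (hC : ∀ w : H10 Ω, ‖valL Ω w‖ ≤ C * gradNorm w)
    (hsmall : √2 * normLinfVec Ω b * C
      + 2 * max (normLinf Ω p) (normLinf Ω n) * C ^ 2 / ε < 1) (R : Fin 3 → L2 Ω) :
    ∃! φ : Fin 3 → H10 Ω, IsLinearizedSolution ε p n b R φ := by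
  have g := gradNorm_nonneg (Ω := Ω)
  have hK : 0 ≤ normLinfVec Ω b := le_max_of_le_left ENNReal.toReal_nonneg
  have hdiff : ∀ (q : Plane → ℝ) (hq : MemLp q ⊤ (vol Ω)),
      normLinf Ω q ≤ max (normLinf Ω p) (normLinf Ω n) → ∀ φ v : H10 Ω,
      |diffusionForm q hq φ v|
        ≤ max (normLinf Ω p) (normLinf Ω n) * gradNorm φ * gradNorm v :=
    fun q hq hqN φ v => (abs_diffusionForm_le hq φ v).trans <|
      mul_le_mul_of_nonneg_right (mul_le_mul_of_nonneg_right hqN (g φ)) (g v)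
  have hconv : ∀ w : H10 Ω, |convectionForm b hb w w|
      ≤ √2 * normLinfVec Ω b * C * gradNorm w ^ 2 := fun w =>
    calc _ ≤ √2 * normLinfVec Ω b * ‖valL Ω w‖ * gradNorm w := abs_convectionForm_le hb w w
      _ ≤ √2 * normLinfVec Ω b * (C * gradNorm w) * gradNorm w :=
          mul_le_mul_of_nonneg_right (mul_le_mul_of_nonneg_left (hC w) (by positivity)) (g w)
      _ = _ := by ring
  have hmass : ∀ φ v : H10 Ω, |massForm Ω φ v| ≤ C ^ 2 * gradNorm φ * gradNorm v := fun φ v =>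
    calc _ ≤ ‖valL Ω φ‖ * ‖valL Ω v‖ := abs_massForm_le φ v
      _ ≤ (C * gradNorm φ) * (C * gradNorm v) :=
          mul_le_mul (hC φ) (hC v) (norm_nonneg _) (mul_nonneg hC0.le (g φ))
      _ = _ := by ring
  have hM0 : 0 ≤ max (normLinf Ω p) (normLinf Ω n) := le_max_of_le_left ENNReal.toReal_nonneg
  have hκ : 0 < 1 + C ^ 2 := by positivity
  have hm : 0 < C ^ 2 := by positivity
  have h := existsUnique_tripleForm (H := H10 Ω) (D := dirichletForm Ω) (P := diffusionForm p hp)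
    (Q := diffusionForm n hn) (T := convectionForm b hb) (M := massForm Ω) (g := gradNorm)
    hε g hκ (fun w => norm_sq_le_of_poincare hC w) (by intro w; exact dirichletForm_self w) hM0 hm
    (by intro φ v; exact hdiff p hp (le_max_left _ _) φ v)
    (by intro φ v; exact hdiff n hn (le_max_right _ _) φ v)
    (by intro w; exact hconv w) (by intro φ v; exact hmass φ v) hsmall (fun k => pairingL (R k))
  simpa only [IsLinearizedSolution, linearizedForm_jets ε hp hn hb, jets, pairingL_apply] using h

/-! ### The G-derivative. -/

theorem hasGDerivative_pnpForm (ε : ℝ) (f : Fin 3 → Plane → ℝ) {p n ψ : Plane → ℝ}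
    (gp gn : Fin 2 → Plane → ℝ) {b : Fin 2 → Plane → ℝ} (φ v : Fin 3 → Jet)
    (hint : ∀ t : ℝ, IntegrableOn
      (pnpIntegrand ε f (![(p, gp), (n, gn), (ψ, b)] + t • φ) v) Ω) :
    HasGDerivative Ω ε f ![(p, gp), (n, gn), (ψ, b)] φ v (linearizedForm Ω ε p n b φ v) := by
  set u : Fin 3 → Jet := ![(p, gp), (n, gn), (ψ, b)] with hu
  set F0 := pnpIntegrand ε f u v with hF0
  set F1 : Plane → ℝ := fun x =>
    (dot (φ 0).2 (v 0).2 x + p x * dot (φ 2).2 (v 0).2 x + (φ 0).1 x * dot b (v 0).2 x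
      + dot (φ 1).2 (v 1).2 x - n x * dot (φ 2).2 (v 1).2 x - (φ 1).1 x * dot b (v 1).2 x
      + ε * dot (φ 2).2 (v 2).2 x - (φ 0).1 x * (v 2).1 x + (φ 1).1 x * (v 2).1 x) with hF1
  set F2 : Plane → ℝ := fun x =>
    (φ 0).1 x * dot (φ 2).2 (v 0).2 x - (φ 1).1 x * dot (φ 2).2 (v 1).2 x with hF2
  have hexp : ∀ t : ℝ, pnpIntegrand ε f (u + t • φ) v
      = fun x => F0 x + t * F1 x + t ^ 2 * F2 x := fun t => by
    ext x
    simp [hF0, hF1, hF2, hu, pnpIntegrand, dot, Fin.sum_univ_two]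
    ring
  simp only [hexp] at hint
  -- The values t = 0, 1, -1 determine a quadratic polynomial, so integrability there gives
  -- integrability of each coefficient: F1 is half the difference at ±1, and F2 is half the sum
  -- minus F0.
  have i0 : Integrable F0 (vol Ω) := by simpa [IntegrableOn] using hint 0
  have ip := hint 1
  have im := hint (-1)
  have i1 : Integrable F1 (vol Ω) := by
    refine ((ip.sub im).const_mul (1 / 2)).congr (Eventually.of_forall fun x => ?_)
    simp; ring
  have i2 : Integrable F2 (vol Ω) := by
    refine (((ip.add im).const_mul (1 / 2)).sub i0).congr (Eventually.of_forall fun x => ?_)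
    simp; ring
  have hform : ∀ t : ℝ, pnpForm Ω ε f (u + t • φ) v
      = pnpForm Ω ε f u v + t * (∫ x in Ω, F1 x) + t ^ 2 * ∫ x in Ω, F2 x := fun t => by
    simp only [pnpForm, hexp]
    refine (integral_add (i0.add (i1.const_mul t)) (i2.const_mul _)).trans ?_
    rw [integral_add' i0 (i1.const_mul t), integral_const_mul, integral_const_mul]
  have hlim : Tendsto (fun t : ℝ => (∫ x in Ω, F1 x) + t * ∫ x in Ω, F2 x) (𝓝[≠] 0)
      (𝓝 (∫ x in Ω, F1 x)) := by
    have : Continuous fun t : ℝ => (∫ x in Ω, F1 x) + t * ∫ x in Ω, F2 x := by fun_prop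
    simpa using (this.tendsto 0).mono_left nhdsWithin_le_nhds
  refine hlim.congr' ?_
  filter_upwards [self_mem_nhdsWithin] with t ht
  have ht : t ≠ 0 := ht
  rw [hform]
  field_simp
  ring

end PNP

theorem lemma3p1 (Ω : Opens Plane)
    (hΩ : Bornology.IsBounded (Ω : Set Plane)) :
    (∃ Cp : ℝ, IsPoissonConstant Ω Cp) ∧
    ∀ Cp : ℝ, IsPoissonConstant Ω Cp →
    ∀ ε : ℝ, 0 < ε →
    ∀ (p n ψ : Plane → ℝ) (gψ : Fin 2 → Plane → ℝ),
      MemLp p ⊤ (vol Ω) → MemLp n ⊤ (vol Ω) → MemW1 Ω ⊤ ψ gψ →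
      normLinfVec Ω gψ + √2 * Cp * ε⁻¹ * max (normLinf Ω p) (normLinf Ω n)
        < √2 / (1 + Cp ^ 2) →
      -- the form below is the G-derivative of the nonlinear system at `(p, n, ψ)`
      (∀ gp gn : Fin 2 → Plane → ℝ, MemW1 Ω 2 p gp → MemW1 Ω 2 n gn →
        ∀ f : Fin 3 → L2 Ω, ∀ φ v : Fin 3 → H10 Ω,
          (∀ t : ℝ, IntegrableOn
            (pnpIntegrand ε (fun k => f k)
              (![(p, gp), (n, gn), (ψ, gψ)] + t • jets φ) (jets v)) Ω) →
          HasGDerivative Ω ε (fun k => f k) ![(p, gp), (n, gn), (ψ, gψ)]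
            (jets φ) (jets v)
            (linearizedForm Ω ε p n gψ (jets φ) (jets v))) ∧
      -- unique solvability of the linearized problem
      ∀ R : Fin 3 → L2 Ω, ∃! φ : Fin 3 → H10 Ω, IsLinearizedSolution ε p n gψ R φ := by
  refine ⟨?_, ?_⟩
  · obtain ⟨C, h0, hC⟩ := exists_poincare hΩ
    exact ⟨C, isPoissonConstant_of_poincare h0 hC⟩
  intro Cp hCp ε hε p n ψ gψ hp hn hψ hsmall
  refine ⟨fun gp gn _ _ f φ v hint => hasGDerivative_pnpForm ε _ gp gn _ _ hint, fun R => ?_⟩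
  have h0 := hCp.1
  refine existsUnique_linearizedSolution hε hp hn hψ.2.2 h0 (hCp.poincare hΩ) ?_ R
  have h2 : √2 * √2 = 2 := Real.mul_self_sqrt (by norm_num)
  -- The factor √2 C_p turns the hypothesis into the coercivity condition; its right side becomes
  -- 2C_p/(1 + C_p²), at most 1 since (C_p - 1)² ≥ 0.
  have h := mul_lt_mul_of_pos_left hsmall (by positivity : 0 < √2 * Cp)
  have hle : √2 * Cp * (√2 / (1 + Cp ^ 2)) ≤ 1 := by
    rw [show √2 * Cp * (√2 / (1 + Cp ^ 2)) = √2 * √2 * Cp / (1 + Cp ^ 2) by ring, h2,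
      div_le_one (by positivity)]
    nlinarith [sq_nonneg (Cp - 1)]
  refine lt_of_eq_of_lt ?_ (h.trans_le hle)
  rw [div_eq_mul_inv]
  linear_combination (-(max (normLinf Ω p) (normLinf Ω n) * Cp ^ 2 * ε⁻¹)) * h2
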